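/- Let $\Sigma$ be a finite alphabet. A semi-Markovian causal graph $G$ is a finite directed acyclic graph on a vertex set $V\cup U$ (observable and unobservable vertices) in which every $u\in U$ is a root with exactly two children, both in $V$. A semi-Markovian Bayesian network (SMBN) $\mathcal M$ on $G$ assigns to each vertex $x$ and each assignment $\pi(x)$ in $\Sigma$ to all its parents a probability distribution $\Pr_{\mathcal M}[\,\cdot\mid\pi(x)]$ on $\Sigma$. For $T\subseteq V$ and $t\in\Sigma^{T}$, the interventional distribution on $\Sigma^V$ is $$P_{\mathcal M}[v\mid do(t)]=\sum_{u\in\Sigma^{U}}\ \prod_{i\in V\setminus T}\Pr\nolimits_{\mathcal M}[v_i\mid\pi(i)]\prod_{k\in U}\Pr\nolimits_{\mathcal M}[u_k]$$ if $v$ agrees with $t$ on $T$, and $0$ otherwise; $P_{\mathcal M}[S\mid do(t)]$ denotes its marginal on $S\subseteq V$. For $X\subseteq V$, the c-components of the induced graph $G[X]$ are the connected components of the graph on $X$ in which two distinct vertices are joined when they have a common unobservable parent. For $S\subseteq V$, $\mathrm{Pa}(S)$ is the set of observable parents of vertices of $S$ that do not lie in $S$. For distributions $P,Q$ on a finite set,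 $H^2(P,Q)=1-\sum_i\sqrt{P(i)Q(i)}$. Theorem. Let $G$ be a semi-Markovian causal graph with $n=|V|$ observable vertices, in which every observable vertex has at most $d$ observable parents and every c-component of $G=G[V]$ has at most $\ell$ vertices. Let $\mathcal M$ and $\mathcal N$ be SMBNs on $G$, let $\gamma\ge 0$ and $T\subseteq V$, and let $C_1,\dots,C_p$ be the c-components of $G[V\setminus T]$. Suppose that $$H^2\big(P_{\mathcal M}[C_j\mid do(a)],\,P_{\mathcal N}[C_j\mid do(a)]\big)\le\gamma\qquad\text{for all } j\in\{1,\dots,p\}\text{ and all } a\in\Sigma^{\mathrm{Pa}(C_j)}.$$ Then $$H^2\big(P_{\mathcal M}[V\setminus T\mid do(t)],\,P_{\mathcal N}[V\setminus T\mid do(t)]\big)\le\gamma\,|\Sigma|^{\ell(d+1)}\,n\qquad\text{for all } t\in\Sigma^{T}.$$ -/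

import Mathlib

/-- A causal graph: a directed acyclic graph on the disjoint union of the observable
vertices `V` (left summand) and the unobservable vertices `U` (right summand). -/
structure CausalGraph (V U : Type*) extends Digraph (V ⊕ U) where
  /-- there is no directed cycle -/
  acyclic : ∀ x, ¬ Relation.TransGen Adj x x

namespace CausalGraph

variable {V U : Type*}

/-- A causal graph is semi-Markovian if every unobservable vertex is a root and has exactly
two children, both of them observable. -/
structure IsSemiMarkovian (G : CausalGraph V U) : Prop where
  root : ∀ (u : U) (x : V ⊕ U), ¬ G.Adj x (Sum.inr u)
  two_children : ∀ u : U, ∃ v w : V, v ≠ w ∧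
    ∀ x : V ⊕ U, G.Adj (Sum.inr u) x ↔ x = Sum.inl v ∨ x = Sum.inl w

/-- The set of all parents (observable and unobservable) of a single vertex. -/
abbrev Parents (G : CausalGraph V U) (x : V ⊕ U) : Type _ := {y : V ⊕ U // G.Adj y x}

open Classical in
/-- The observable parents `Pa(S)` of a set `S` of observable vertices, excluding `S`. -/
noncomputable def obsParents [Fintype V] (G : CausalGraph V U) (S : Finset V) : Finset V :=
  Finset.univ.filter fun v => v ∉ S ∧ ∃ w ∈ S, G.Adj (Sum.inl v) (Sum.inl w)

/-- The bi-directed edges of the induced subgraph `G[X]`: two distinct observable vertices,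
both in `X`, are joined if they have a common unobservable parent. -/
def bidirected (G : CausalGraph V U) (X : Finset V) : SimpleGraph V where
  Adj v w := v ≠ w ∧ v ∈ X ∧ w ∈ X ∧
    ∃ u : U, G.Adj (Sum.inr u) (Sum.inl v) ∧ G.Adj (Sum.inr u) (Sum.inl w)
  symm := ⟨fun _ _ ⟨h, hv, hw, u, h₁, h₂⟩ => ⟨h.symm, hw, hv, u, h₂, h₁⟩⟩
  loopless := ⟨fun _ h => h.1 rfl⟩

/-- `S` is a c-component of the induced subgraph `G[X]`: a maximal (nonempty) subset of `X` such
that any two of its vertices are joined by a path of bi-directed edges of `G[X]`. -/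
def IsCComponent (G : CausalGraph V U) (X S : Finset V) : Prop :=
  Maximal (fun S : Finset V => S.Nonempty ∧ S ⊆ X ∧
    ∀ v ∈ S, ∀ w ∈ S, (G.bidirected X).Reachable v w) S

/-- The class of semi-Markovian causal graphs in which every observable vertex has at most `d`
observable parents and every c-component (of the whole graph) has at most `l` elements. -/
structure InClass [Fintype V] (G : CausalGraph V U) (d l : ℕ) : Prop where
  semiMarkovian : G.IsSemiMarkovian
  inDegree_le : ∀ v : V, (G.obsParents {v}).card ≤ d
  cComponent_le : ∀ S : Finset V, G.IsCComponent Finset.univ S → S.card ≤ l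

end CausalGraph

/-- A causal Bayesian network on the causal graph `G` with alphabet `A`: for every (observable or
unobservable) vertex and every assignment to all of its parents, a probability distribution
on `A`. It is a semi-Markovian Bayesian network if `G` is semi-Markovian. -/
structure CausalBayesNet {V U : Type*} (G : CausalGraph V U) (A : Type*) [Fintype A] where
  /-- `cond x p a` is the probability that `x` takes the value `a`, given that its parents
  take the values `p` -/
  cond : ∀ x : V ⊕ U, (G.Parents x → A) → A → ℝ
  cond_nonneg : ∀ x p a, 0 ≤ cond x p a
  sum_cond : ∀ x p, ∑ a, cond x p a = 1

namespace CausalBayesNet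

variable {V U : Type*} [Fintype V] [DecidableEq V] [Fintype U] [DecidableEq U]
  {G : CausalGraph V U} {A : Type*} [Fintype A]

/-- The factor `Pr[x | π(x)]` evaluated at a joint assignment to all vertices. -/
def factor (M : CausalBayesNet G A) (z : V ⊕ U → A) (x : V ⊕ U) : ℝ :=
  M.cond x (fun y => z y.1) (z x)

open Classical in
/-- The interventional probability `P[v | do(t)]` of a full observable assignment `v` under the
intervention that sets the vertices of `T` to `t`. -/
noncomputable def doProb (M : CausalBayesNet G A) (T : Finset V) (t : T → A) (v : V → A) : ℝ :=
  if ∀ i : T, v i = t i then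
    ∑ u : U → A, (∏ i ∈ Tᶜ, M.factor (Sum.elim v u) (Sum.inl i)) *
      ∏ k : U, M.factor (Sum.elim v u) (Sum.inr k)
  else 0

open Classical in
/-- The interventional distribution `P[S | do(t)]`: the marginal on `S` of the interventional
distribution on all observable vertices. -/
noncomputable def doMarginal (M : CausalBayesNet G A) (T : Finset V) (t : T → A) (S : Finset V)
    (s : S → A) : ℝ :=
  ∑ v : V → A with (∀ i : S, v i = s i), M.doProb T t v

end CausalBayesNet

/-- The squared Hellinger distance `1 - ∑ √(P i * Q i)` between two distributions on a finite
type, given by their probability mass functions. -/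
noncomputable def sqHellinger {α : Type*} [Fintype α] (P Q : α → ℝ) : ℝ :=
  1 - ∑ i, Real.sqrt (P i * Q i)

/-! The distance is one minus the Bhattacharyya coefficient (`affinity`) of the two c-factors. The
core, `one_sub_affinity_le`, bounds this by the sum, over the c-components `C` and all values of
`Pa(C)`, of the local distances. Since c-factors of sets without common unobservable parents
multiply, one can build `Tᶜ` one vertex at a time, each new vertex `i` being a sink.

If `C` is the c-component of `i`, the c-factor of `S` is that of `X = C ∩ S` times that of `R = S \
C`, and only the first changes when `i` is added. Summing out the sink `i` gives back the old
c-factor, so by Cauchy–Schwarz the root of the product of the c-factors of `X` drops by some `b ≥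
0`, which depends only on `C` and `Pa(C)`. Replacing `b` by its sum over the values of `Pa(C)`
decouples it from `R`, whose affinity is at most 1 (`affinity_sub_affinity_insert_le`). The losses
inside one component telescope to its local distance.

There are at most `n` components, each with at most `|Σ|^(ℓd)` parent assignments. -/

/-- The sum of `f` over all functions that agree with `v` outside `D`. -/
noncomputable def coordSum {V A : Type*} [Fintype V] [Fintype A] (D : Finset V)
    (f : (V → A) → ℝ) (v : V → A) : ℝ :=
  open Classical in ∑ x : V → A with (∀ i ∉ D, x i = v i), f x

/-! ### Partial sums over coordinates -/

section coordSum

variable {V A : Type*} [Fintype V] [Fintype A]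

theorem coordSum_mono_of {D : Finset V} {f g : (V → A) → ℝ} {v : V → A}
    (h : ∀ x : V → A, (∀ i ∉ D, x i = v i) → f x ≤ g x) : coordSum D f v ≤ coordSum D g v := by
  classical
  exact Finset.sum_le_sum fun x hx => h x (by simpa using hx)

theorem coordSum_congr {D : Finset V} {f g : (V → A) → ℝ} {v : V → A}
    (h : ∀ x : V → A, (∀ i ∉ D, x i = v i) → f x = g x) : coordSum D f v = coordSum D g v := by
  classical
  exact Finset.sum_congr rfl fun x hx => h x (by simpa using hx)

theorem coordSum_sub (D : Finset V) (f g : (V → A) → ℝ) (v : V → A) :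
    coordSum D (fun x => f x - g x) v = coordSum D f v - coordSum D g v := by
  simp [coordSum, Finset.sum_sub_distrib]

theorem coordSum_add (D : Finset V) (f g : (V → A) → ℝ) (v : V → A) :
    coordSum D (fun x => f x + g x) v = coordSum D f v + coordSum D g v := by
  simp [coordSum, Finset.sum_add_distrib]

theorem coordSum_mul_const (D : Finset V) (f : (V → A) → ℝ) (c : ℝ) (v : V → A) :
    coordSum D (fun x => f x * c) v = coordSum D f v * c := by
  simp [coordSum, Finset.sum_mul]

theorem coordSum_empty (f : (V → A) → ℝ) (v : V → A) : coordSum ∅ f v = f v := by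
  classical
  unfold coordSum
  rw [Finset.sum_eq_single v]
  · intro x hx hne
    exact absurd (funext fun i => by simpa using (Finset.mem_filter.1 hx).2 i) hne
  · intro h
    exact absurd (by simp) h

theorem coordSum_union [DecidableEq V] {D E : Finset V} (hDE : Disjoint D E)
    (f : (V → A) → ℝ) (v : V → A) :
    coordSum (D ∪ E) f v = coordSum D (coordSum E f) v := by
  classical
  unfold coordSum
  rw [Finset.sum_sigma']
  -- The intermediate point is forced by `x`: it equals `x` on `D` and `v` elsewhere.
  refine Finset.sum_bij' (fun x _ => ⟨fun i => if i ∈ D then x i else v i, x⟩)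
    (fun p _ => p.2) ?_ ?_ ?_ ?_ ?_
  · intro x hx
    simp only [Finset.mem_filter, Finset.mem_univ, true_and, Finset.mem_union, not_or,
      Finset.mem_sigma] at hx ⊢
    refine ⟨fun i hi => by simp [hi], fun i hi => ?_⟩
    by_cases h : i ∈ D
    · simp [h]
    · simp [h, hx i ⟨h, hi⟩]
  · rintro ⟨y, x⟩ hp
    simp only [Finset.mem_filter, Finset.mem_univ, true_and, Finset.mem_union, not_or,
      Finset.mem_sigma] at hp ⊢
    exact fun i hi => (hp.2 i hi.2).trans (hp.1 i hi.1)
  · intro x _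
    rfl
  · rintro ⟨y, x⟩ hp
    simp only [Finset.mem_filter, Finset.mem_univ, true_and,
      Finset.mem_sigma] at hp
    have : (fun i => if i ∈ D then x i else v i) = y := by
      funext i
      by_cases h : i ∈ D
      · simp [h, hp.2 i (Finset.disjoint_left.1 hDE h)]
      · simp [h, hp.1 i h]
    simp [this]
  · intro x _
    rfl

theorem coordSum_singleton [DecidableEq V] (i : V) (f : (V → A) → ℝ) (v : V → A) :
    coordSum {i} f v = ∑ a, f (Function.update v i a) := by
  classical
  unfold coordSum
  refine Finset.sum_bij' (fun x _ => x i) (fun a _ => Function.update v i a) ?_ ?_ ?_ ?_ ?_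
  · simp
  · intro a _
    simp +contextual
  · intro x hx
    funext j
    by_cases h : j = i
    · subst h; simp
    · simp only [Finset.mem_filter, Finset.mem_univ, true_and, Finset.mem_singleton] at hx
      simp [h, hx j h]
  · simp
  · intro x hx
    congr 1
    funext j
    by_cases h : j = i
    · subst h; simp
    · simp only [Finset.mem_filter, Finset.mem_univ, true_and, Finset.mem_singleton] at hx
      simp [h, hx j h]

theorem le_coordSum {D : Finset V} {f : (V → A) → ℝ} (hf : ∀ x, 0 ≤ f x) {v x : V → A}
    (hx : ∀ i ∉ D, x i = v i) : f x ≤ coordSum D f v := by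
  classical
  exact Finset.single_le_sum (f := f) (fun y _ => hf y) (by simpa using hx)

/-- A sum over assignments to `S`, expressed by full assignments extending a fixed one. -/
theorem sum_eq_coordSum [DecidableEq V] {S : Finset V} {f : (S → A) → ℝ}
    {h : (V → A) → ℝ} {v : V → A}
    (hf : ∀ x : V → A, (∀ i ∉ S, x i = v i) → f (fun i => x i) = h x) :
    ∑ s, f s = coordSum S h v := by
  classical
  unfold coordSum
  symm
  have key : ∀ s : S → A, ∀ i ∉ S, (fun i => if hi : i ∈ S then s ⟨i, hi⟩ else v i) i = v i := by
    intro s i hi; simp [hi]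
  refine Finset.sum_bij' (fun x _ => fun i : S => x i)
    (fun s _ => fun i => if hi : i ∈ S then s ⟨i, hi⟩ else v i) ?_ ?_ ?_ ?_ ?_
  · simp
  · intro s _
    simpa using key s
  · intro x hx
    simp only [Finset.mem_filter, Finset.mem_univ, true_and] at hx
    funext i
    by_cases hi : i ∈ S
    · simp [hi]
    · simp [hi, hx i hi]
  · intro s _
    funext i
    simp
  · intro x hx
    simp only [Finset.mem_filter, Finset.mem_univ, true_and] at hx
    exact (hf x hx).symm

theorem coordSum_const [DecidableEq V] (D : Finset V) (c : ℝ) (v : V → A) :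
    coordSum D (fun _ => c) v = (Fintype.card A : ℝ) ^ D.card * c := by
  rw [← sum_eq_coordSum (S := D) (f := fun _ => c) (fun _ _ => rfl)]
  simp

theorem coordSum_comm [DecidableEq V] {D E : Finset V} (hDE : Disjoint D E)
    (f : (V → A) → ℝ) (v : V → A) :
    coordSum D (coordSum E f) v = coordSum E (coordSum D f) v := by
  rw [← coordSum_union hDE, Finset.union_comm, coordSum_union hDE.symm]

theorem coordSum_sqrt_mul_le (D : Finset V) {f g : (V → A) → ℝ} (hf : ∀ x, 0 ≤ f x)
    (hg : ∀ x, 0 ≤ g x) (v : V → A) :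
    coordSum D (fun x => √(f x * g x)) v ≤ √(coordSum D f v * coordSum D g v) := by
  classical
  unfold coordSum
  rw [Real.sqrt_mul (Finset.sum_nonneg fun x _ => hf x)]
  simp_rw [fun x => Real.sqrt_mul (hf x) (g x)]
  exact Real.sum_sqrt_mul_sqrt_le _ hf hg

end coordSum

/-- Independence of functions of complementary sets of coordinates under a product weight. -/
theorem sum_mul_mul_prod_eq {U A : Type*} [Fintype U] [DecidableEq U] [Fintype A]
    (p : U → A → ℝ) (hp : ∀ k, ∑ a, p k a = 1) (K : Set U) (F H : (U → A) → ℝ)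
    (hF : ∀ u u', (∀ k ∈ K, u k = u' k) → F u = F u')
    (hH : ∀ u u', (∀ k ∉ K, u k = u' k) → H u = H u') :
    ∑ u, F u * H u * ∏ k, p k (u k) =
      (∑ u, F u * ∏ k, p k (u k)) * ∑ u, H u * ∏ k, p k (u k) := by
  classical
  have htot : ∑ u : U → A, ∏ k, p k (u k) = 1 := by
    rw [← Fintype.prod_sum]; simp [hp]
  have h1 : ∑ u, F u * H u * ∏ k, p k (u k) =
      ∑ z : (U → A) × (U → A), (F z.1 * H z.1 * ∏ k, p k (z.1 k)) * ∏ k, p k (z.2 k) := by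
    rw [Fintype.sum_prod_type]
    simp_rw [← Finset.mul_sum, htot, mul_one]
  rw [h1, Finset.sum_mul_sum, ← Fintype.sum_prod_type']
  -- Having inserted an independent second copy of total mass 1, exchange the coordinates outside
  -- `K` between the copies; the product weight is unchanged.
  let m : (U → A) × (U → A) → (U → A) × (U → A) := fun z =>
    (fun k => if k ∈ K then z.1 k else z.2 k, fun k => if k ∈ K then z.2 k else z.1 k)
  have hm : Function.Involutive m := by
    rintro ⟨x, y⟩
    ext k <;> by_cases h : k ∈ K <;> simp [m, h]
  refine (Fintype.sum_equiv hm.toPerm _ _ ?_).symm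
  rintro ⟨x, y⟩
  have e1 : F (m (x, y)).1 = F x := hF _ _ fun k hk => by simp [m, hk]
  have e2 : H (m (x, y)).1 = H y := hH _ _ fun k hk => by simp [m, hk]
  have e3 : (∏ k, p k ((m (x, y)).1 k)) * ∏ k, p k ((m (x, y)).2 k) =
      (∏ k, p k (x k)) * ∏ k, p k (y k) := by
    rw [← Finset.prod_mul_distrib, ← Finset.prod_mul_distrib]
    refine Finset.prod_congr rfl fun k _ => ?_
    by_cases h : k ∈ K <;> simp [m, h, mul_comm]
  simp only [Function.Involutive.coe_toPerm]
  rw [mul_assoc (F _ * H _), e3, e1, e2]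
  ring

/-! ### Sinks, c-components and parent sets -/

namespace CausalGraph

variable {V U : Type*} {G : CausalGraph V U}

theorem wellFounded_transGen_adj [Finite V] [Finite U] (G : CausalGraph V U) :
    WellFounded (Relation.TransGen G.Adj) :=
  have : Std.Irrefl (Relation.TransGen G.Adj) := ⟨G.acyclic⟩
  Finite.wellFounded_of_trans_of_irrefl _

theorem not_adj_self (G : CausalGraph V U) (x : V ⊕ U) : ¬ G.Adj x x :=
  fun h => G.acyclic x (.single h)

/-- Every nonempty set of observable vertices has a sink. -/
theorem exists_sink [Finite V] (G : CausalGraph V U) {S : Finset V} (hS : S.Nonempty) :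
    ∃ i ∈ S, ∀ j ∈ S, ¬ G.Adj (Sum.inl i) (Sum.inl j) := by
  -- The order is reversed, so that a minimal element of `S` has no descendant in `S`.
  let r : V → V → Prop := fun i j => Relation.TransGen G.Adj (Sum.inl j) (Sum.inl i)
  have : IsTrans V r := ⟨fun _ _ _ h h' => h'.trans h⟩
  have : Std.Irrefl r := ⟨fun i => G.acyclic _⟩
  obtain ⟨i, hi, hmin⟩ := (Finite.wellFounded_of_trans_of_irrefl r).has_min (S : Set V) hS
  exact ⟨i, hi, fun j hj h => hmin j hj (.single h)⟩

theorem mem_obsParents [Fintype V] {S : Finset V} {v : V} :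
    v ∈ G.obsParents S ↔ v ∉ S ∧ ∃ w ∈ S, G.Adj (Sum.inl v) (Sum.inl w) := by
  classical
  simp [obsParents]

/-- The vertices with which `i` is joined by a bi-directed path form a c-component. -/
theorem exists_isCComponent [Finite V] (G : CausalGraph V U) {X : Finset V} {i : V} (hi : i ∈ X) :
    ∃ C, G.IsCComponent X C ∧ i ∈ C := by
  classical
  refine ⟨X.filter fun w => (G.bidirected X).Reachable i w, ⟨⟨⟨i, ?_⟩, ?_, ?_⟩, ?_⟩, ?_⟩
  · simp [hi]
  · exact Finset.filter_subset _ _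
  · intro v hv w hw
    exact (Finset.mem_filter.1 hv).2.symm.trans (Finset.mem_filter.1 hw).2
  · rintro D ⟨-, hDX, hD⟩ hle w hw
    exact Finset.mem_filter.2 ⟨hDX hw, hD i (hle (by simp [hi])) w hw⟩
  · simp [hi]

/-- A c-component contains every vertex reachable from one of its vertices. -/
theorem IsCComponent.mem_of_reachable {X C : Finset V} (hC : G.IsCComponent X C) {i j : V}
    (hi : i ∈ C) (hj : j ∈ X) (h : (G.bidirected X).Reachable i j) : j ∈ C := by
  classical
  obtain ⟨⟨-, hCX, hreach⟩, hmax⟩ := hC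
  have hij : ∀ v ∈ C, (G.bidirected X).Reachable v j := fun v hv => (hreach v hv i hi).trans h
  refine hmax (y := insert j C) ⟨Finset.insert_nonempty _ _,
    Finset.insert_subset hj hCX, ?_⟩ (Finset.subset_insert _ _) (Finset.mem_insert_self _ _)
  intro v hv w hw
  rcases Finset.mem_insert.1 hv with hv | hv <;> rcases Finset.mem_insert.1 hw with hw | hw
  · exact hv ▸ hw ▸ .refl _
  · exact hv ▸ (hij w hw).symm
  · exact hw ▸ hij v hv
  · exact hreach v hv w hw

theorem IsCComponent.eq_of_mem {X C D : Finset V} (hC : G.IsCComponent X C)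
    (hD : G.IsCComponent X D) {i : V} (hi : i ∈ C) (hi' : i ∈ D) : C = D :=
  Finset.Subset.antisymm
    (fun j hj => hD.mem_of_reachable hi' (hC.1.2.1 hj) (hC.1.2.2 i hi j hj))
    (fun j hj => hC.mem_of_reachable hi (hD.1.2.1 hj) (hD.1.2.2 i hi' j hj))

theorem IsCComponent.mem_of_common_parent {X C : Finset V} (hC : G.IsCComponent X C) {i j : V}
    (hi : i ∈ C) (hj : j ∈ X) {u : U} (hui : G.Adj (Sum.inr u) (Sum.inl i))
    (huj : G.Adj (Sum.inr u) (Sum.inl j)) : j ∈ C := by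
  by_cases h : i = j
  · exact h ▸ hi
  · exact hC.mem_of_reachable hi hj
      (SimpleGraph.Adj.reachable ⟨h, hC.1.2.1 hi, hj, u, hui, huj⟩)

open Classical in
theorem card_cComponents_le [Fintype V] (G : CausalGraph V U) (X : Finset V) :
    (Finset.univ.filter fun C => G.IsCComponent X C).card ≤ Fintype.card V := by
  rw [← Finset.card_univ]
  refine Finset.card_le_card_of_forall_subsingleton (fun C i => i ∈ C) (fun C hC => ?_) ?_
  · obtain ⟨i, hi⟩ := (Finset.mem_filter.1 hC).2.1.1
    exact ⟨i, Finset.mem_univ i, hi⟩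
  · rintro i - C ⟨hC, hiC⟩ D ⟨hD, hiD⟩
    exact (Finset.mem_filter.1 hC).2.eq_of_mem (Finset.mem_filter.1 hD).2 hiC hiD

theorem bidirected_mono {X Y : Finset V} (h : X ⊆ Y) : G.bidirected X ≤ G.bidirected Y :=
  fun _ _ ⟨hne, hv, hw, hu⟩ => ⟨hne, h hv, h hw, hu⟩

variable [Fintype V] {d l : ℕ}

/-- Restricting to `X` only removes bi-directed edges, so `C` lies inside a c-component of the whole
graph. -/
theorem InClass.card_le (hG : G.InClass d l) {X C : Finset V} (hC : G.IsCComponent X C) :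
    C.card ≤ l := by
  obtain ⟨i, hi⟩ := hC.1.1
  obtain ⟨D, hD, hiD⟩ := G.exists_isCComponent (Finset.mem_univ i)
  refine (Finset.card_le_card fun j hj => ?_).trans (hG.cComponent_le D hD)
  exact hD.mem_of_reachable hiD (Finset.mem_univ j)
    ((hC.1.2.2 i hi j hj).mono (bidirected_mono (Finset.subset_univ X)))

theorem InClass.card_obsParents_le (hG : G.InClass d l) {X C : Finset V}
    (hC : G.IsCComponent X C) : (G.obsParents C).card ≤ l * (d + 1) := by
  classical
  have hsub : G.obsParents C ⊆ C.biUnion fun v => G.obsParents {v} := by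
    intro v hv
    obtain ⟨-, w, hw, hvw⟩ := mem_obsParents.1 hv
    refine Finset.mem_biUnion.2 ⟨w, hw, mem_obsParents.2 ⟨?_, w, by simp, hvw⟩⟩
    rintro h
    rw [Finset.mem_singleton] at h
    exact G.not_adj_self _ (h ▸ hvw)
  calc (G.obsParents C).card ≤ C.card * d :=
        (Finset.card_le_card hsub).trans
          (Finset.card_biUnion_le_card_mul _ _ _ fun v _ => hG.inDegree_le v)
    -- Already `l * d` would do; the weaker exponent is the one in the theorem.
    _ ≤ l * (d + 1) := Nat.mul_le_mul (hG.card_le hC) (Nat.le_succ d)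

end CausalGraph

/-! ### c-factors: factorization and marginalization -/

namespace CausalBayesNet

variable {V U : Type*} {G : CausalGraph V U} {A : Type*} [Fintype A]

/-- A source of the graph carries an unconditional distribution on `A`, and an empty sum is not 1.
-/
theorem nonempty_alphabet [Finite V] [Finite U] [Nonempty V] (M : CausalBayesNet G A) :
    Nonempty A := by
  obtain ⟨x, -, hx⟩ := G.wellFounded_transGen_adj.has_min Set.univ
    (Set.univ_nonempty (α := V ⊕ U))
  by_contra h
  rw [not_nonempty_iff] at h
  have := M.sum_cond x fun y => absurd (.single y.2) (hx y.1 trivial)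
  simp at this

theorem factor_nonneg (M : CausalBayesNet G A) (z : V ⊕ U → A) (x : V ⊕ U) :
    0 ≤ M.factor z x :=
  M.cond_nonneg _ _ _

theorem factor_congr (M : CausalBayesNet G A) {z z' : V ⊕ U → A} {x : V ⊕ U} (hx : z x = z' x)
    (h : ∀ y, G.Adj y x → z y = z' y) : M.factor z x = M.factor z' x := by
  unfold factor
  rw [hx, show (fun y : G.Parents x => z y.1) = fun y => z' y.1 from funext fun y => h _ y.2]

/-- The distribution of an unobservable vertex of a semi-Markovian graph. -/
def rootProb (M : CausalBayesNet G A) (hG : G.IsSemiMarkovian) (k : U) : A → ℝ :=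
  M.cond (Sum.inr k) fun y => absurd y.2 (hG.root k y.1)

theorem factor_inr (M : CausalBayesNet G A) (hG : G.IsSemiMarkovian) (v : V → A) (u : U → A)
    (k : U) : M.factor (Sum.elim v u) (Sum.inr k) = M.rootProb hG k (u k) := by
  unfold factor rootProb
  refine congrArg (fun p => M.cond (Sum.inr k) p (u k)) (funext ?_)
  exact fun y => absurd y.2 (hG.root k y.1)

theorem sum_rootProb (M : CausalBayesNet G A) (hG : G.IsSemiMarkovian) (k : U) :
    ∑ a, M.rootProb hG k a = 1 :=
  M.sum_cond _ _

variable [Fintype U] [DecidableEq U]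

/-- The probability that the vertices of `X` take the values `v` when all the other observable
vertices are set to the values `v` by an intervention. -/
noncomputable def cFactor (M : CausalBayesNet G A) (X : Finset V) (v : V → A) : ℝ :=
  ∑ u : U → A, (∏ i ∈ X, M.factor (Sum.elim v u) (Sum.inl i)) *
    ∏ k : U, M.factor (Sum.elim v u) (Sum.inr k)

theorem cFactor_nonneg (M : CausalBayesNet G A) (X : Finset V) (v : V → A) :
    0 ≤ M.cFactor X v :=
  Finset.sum_nonneg fun _ _ => mul_nonneg (Finset.prod_nonneg fun _ _ => M.factor_nonneg _ _)
    (Finset.prod_nonneg fun _ _ => M.factor_nonneg _ _)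

theorem cFactor_eq (M : CausalBayesNet G A) (hG : G.IsSemiMarkovian) (X : Finset V)
    (v : V → A) : M.cFactor X v = ∑ u : U → A, (∏ i ∈ X, M.factor (Sum.elim v u) (Sum.inl i)) *
      ∏ k : U, M.rootProb hG k (u k) := by
  simp only [cFactor, M.factor_inr hG]

theorem cFactor_congr (M : CausalBayesNet G A) (hG : G.IsSemiMarkovian) {X : Finset V}
    {v v' : V → A} (hX : ∀ i ∈ X, v i = v' i)
    (h : ∀ i ∈ X, ∀ j, G.Adj (Sum.inl j) (Sum.inl i) → v j = v' j) :
    M.cFactor X v = M.cFactor X v' := by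
  rw [M.cFactor_eq hG, M.cFactor_eq hG]
  refine Finset.sum_congr rfl fun u _ => ?_
  congr 1
  refine Finset.prod_congr rfl fun i hi => M.factor_congr (by simpa using hX i hi) ?_
  rintro (j | k) hj
  · simpa using h i hi j hj
  · rfl

theorem cFactor_empty (M : CausalBayesNet G A) (hG : G.IsSemiMarkovian) (v : V → A) :
    M.cFactor ∅ v = 1 := by
  rw [M.cFactor_eq hG]
  simp only [Finset.prod_empty, one_mul]
  rw [← Fintype.prod_sum]
  simp [sum_rootProb]

/-- The factors of `X` read only unobservable parents of `X`, those of `Y` only the others, and the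
unobservable vertices are independent. -/
theorem cFactor_union [DecidableEq V] (M : CausalBayesNet G A) (hG : G.IsSemiMarkovian)
    {X Y : Finset V} (hXY : Disjoint X Y)
    (h : ∀ i ∈ X, ∀ j ∈ Y, ∀ u : U, G.Adj (Sum.inr u) (Sum.inl i) →
      ¬ G.Adj (Sum.inr u) (Sum.inl j)) (v : V → A) :
    M.cFactor (X ∪ Y) v = M.cFactor X v * M.cFactor Y v := by
  simp only [M.cFactor_eq hG, Finset.prod_union hXY]
  refine sum_mul_mul_prod_eq (M.rootProb hG) (M.sum_rootProb hG)
    {k | ∃ i ∈ X, G.Adj (Sum.inr k) (Sum.inl i)} _ _ ?_ ?_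
  · intro u u' huu'
    refine Finset.prod_congr rfl fun i hi => M.factor_congr rfl ?_
    rintro (j | k) hj
    · rfl
    · exact huu' k ⟨i, hi, hj⟩
  · intro u u' huu'
    refine Finset.prod_congr rfl fun i hi => M.factor_congr rfl ?_
    rintro (j | k) hj
    · rfl
    · exact huu' k fun ⟨i', hi', hk⟩ => h i' hi' i hi k hk hj

theorem cFactor_inter_mul_sdiff [DecidableEq V] (M : CausalBayesNet G A) (hG : G.IsSemiMarkovian)
    {W C S : Finset V} (hC : G.IsCComponent W C) (hS : S ⊆ W) (v : V → A) :
    M.cFactor S v = M.cFactor (C ∩ S) v * M.cFactor (S \ C) v := by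
  have hdisj : Disjoint (C ∩ S) (S \ C) :=
    Finset.disjoint_sdiff.mono_left Finset.inter_subset_left
  rw [← M.cFactor_union hG hdisj]
  · rw [Finset.inter_comm, Finset.union_comm, Finset.sdiff_union_inter]
  · intro i hi j hj u hui huj
    rw [Finset.mem_sdiff] at hj
    exact hj.2 (hC.mem_of_common_parent (Finset.mem_inter.1 hi).1 (hS hj.1) hui huj)

variable [Fintype V] [DecidableEq V]

/-- Only the factor of `i` itself involves the value of `i`, and it sums to 1. -/
theorem coordSum_singleton_cFactor (M : CausalBayesNet G A) (hG : G.IsSemiMarkovian)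
    {S : Finset V} {i : V} (hi : i ∉ S) (h : ∀ j ∈ S, ¬ G.Adj (Sum.inl i) (Sum.inl j))
    (v : V → A) : coordSum {i} (M.cFactor (insert i S)) v = M.cFactor S v := by
  rw [coordSum_singleton]
  simp only [M.cFactor_eq hG, Finset.prod_insert hi]
  rw [Finset.sum_comm]
  refine Finset.sum_congr rfl fun u _ => ?_
  have hS : ∀ a, ∏ j ∈ S, M.factor (Sum.elim (Function.update v i a) u) (Sum.inl j) =
      ∏ j ∈ S, M.factor (Sum.elim v u) (Sum.inl j) := by
    intro a
    refine Finset.prod_congr rfl fun j hj => M.factor_congr ?_ ?_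
    · have : j ≠ i := fun e => hi (e ▸ hj)
      simp [this]
    · rintro (y | k) hy
      · have : y ≠ i := fun e => h j hj (e ▸ hy)
        simp [this]
      · rfl
  have hf : ∀ a, M.factor (Sum.elim (Function.update v i a) u) (Sum.inl i) =
      M.cond (Sum.inl i) (fun y => Sum.elim v u y.1) a := by
    intro a
    unfold factor
    congr 1
    · funext ⟨y, hy⟩
      rcases y with y | k
      · have : y ≠ i := fun e => G.not_adj_self _ (e ▸ hy)
        simp [this]
      · rfl
    · simp
  simp only [hS, hf, ← Finset.sum_mul, M.sum_cond, one_mul]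

/-- Vertices without children in `C` can be summed out. -/
theorem coordSum_cFactor_union (M : CausalBayesNet G A) (hG : G.IsSemiMarkovian)
    {C D : Finset V} (hCD : Disjoint C D)
    (h : ∀ i ∈ D, ∀ j ∈ C, ¬ G.Adj (Sum.inl i) (Sum.inl j)) (v : V → A) :
    coordSum D (M.cFactor (C ∪ D)) v = M.cFactor C v := by
  induction D using Finset.strongInduction generalizing v with
  | H D ih =>
    rcases D.eq_empty_or_nonempty with rfl | hD
    · rw [coordSum_empty, Finset.union_empty]
    obtain ⟨i, hi, hsink⟩ := G.exists_sink hD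
    have hD' : D = D.erase i ∪ {i} := by
      rw [Finset.union_comm, ← Finset.insert_eq, Finset.insert_erase hi]
    have hins : C ∪ D = insert i (C ∪ D.erase i) := by
      rw [← Finset.union_insert, Finset.insert_erase hi]
    have hiC : i ∉ C := Finset.disjoint_right.1 hCD hi
    have hsum : coordSum {i} (M.cFactor (C ∪ D)) = M.cFactor (C ∪ D.erase i) := by
      funext x
      rw [hins]
      refine M.coordSum_singleton_cFactor hG (by simp [hiC]) ?_ x
      intro j hj
      rcases Finset.mem_union.1 hj with hj | hj
      · exact h i hi j hj
      · exact hsink j (Finset.mem_of_mem_erase hj)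
    calc coordSum D (M.cFactor (C ∪ D)) v
        = coordSum (D.erase i ∪ {i}) (M.cFactor (C ∪ D)) v := by rw [← hD']
      _ = coordSum (D.erase i) (M.cFactor (C ∪ D.erase i)) v := by
          rw [coordSum_union (by simp), hsum]
      _ = M.cFactor C v := ih _ (Finset.erase_ssubset hi)
          (hCD.mono_right (Finset.erase_subset _ _))
          (fun j hj => h j (Finset.mem_of_mem_erase hj)) v

theorem coordSum_cFactor (M : CausalBayesNet G A) (hG : G.IsSemiMarkovian)
    (D : Finset V) (v : V → A) : coordSum D (M.cFactor D) v = 1 := by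
  have := M.coordSum_cFactor_union hG (Finset.disjoint_empty_left D) (by simp) v
  rwa [Finset.empty_union, M.cFactor_empty hG] at this

/-- Vertices outside `T ∪ S` have no children in `S`, so they sum out. This covers both `S = Tᶜ` and
`T = Pa(S)`. -/
theorem doMarginal_eq (M : CausalBayesNet G A) (hG : G.IsSemiMarkovian) {T S : Finset V}
    (hTS : Disjoint T S) (h : ∀ i ∉ T, i ∉ S → ∀ j ∈ S, ¬ G.Adj (Sum.inl i) (Sum.inl j))
    (v : V → A) :
    M.doMarginal T (fun i => v i) S (fun i => v i) = M.cFactor S v := by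
  classical
  have hST : Disjoint S (T ∪ S)ᶜ :=
    Finset.disjoint_left.2 fun i hi hi' => by simp [hi] at hi'
  have hunion : S ∪ (T ∪ S)ᶜ = Tᶜ := by
    ext i
    have : i ∈ T → i ∉ S := fun hi => Finset.disjoint_left.1 hTS hi
    simp only [Finset.mem_union, Finset.mem_compl]
    tauto
  rw [← M.coordSum_cFactor_union hG hST (fun i hi => h i (by simp at hi; tauto)
    (by simp at hi; tauto)) v, hunion]
  unfold doMarginal coordSum doProb
  rw [← Finset.sum_filter, Finset.filter_filter]
  refine Finset.sum_congr ?_ fun _ _ => rfl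
  ext x
  simp only [Finset.mem_filter, Finset.mem_univ, true_and, Finset.mem_compl, not_not,
    Finset.mem_union, Subtype.forall]
  constructor
  · rintro ⟨h1, h2⟩ i (hi | hi)
    exacts [h2 i hi, h1 i hi]
  · exact fun h => ⟨fun i hi => h i (.inr hi), fun i hi => h i (.inl hi)⟩

end CausalBayesNet

/-! ### Subadditivity over c-components -/

namespace CausalBayesNet

variable {V U : Type*} [Fintype V] [DecidableEq V] [Fintype U] [DecidableEq U]
  {G : CausalGraph V U} {A : Type*} [Fintype A]

/-- The Bhattacharyya coefficient of the two distributions of the vertices in `X` when all the other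
observable vertices are set to the values `v` by an intervention. -/
noncomputable def affinity (M N : CausalBayesNet G A) (X : Finset V) (v : V → A) : ℝ :=
  coordSum X (fun x => √(M.cFactor X x * N.cFactor X x)) v

theorem affinity_le_one (M N : CausalBayesNet G A) (hG : G.IsSemiMarkovian) (X : Finset V)
    (v : V → A) : affinity M N X v ≤ 1 := by
  refine (coordSum_sqrt_mul_le X (M.cFactor_nonneg X) (N.cFactor_nonneg X) v).trans ?_
  simp [coordSum_cFactor _ hG]

/-- Adding a sink `i` to a set of vertices decreases the affinity at most as much as it does
within the c-component of `i`, summed over the values of the parents of this c-component. -/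
theorem affinity_sub_affinity_insert_le (M N : CausalBayesNet G A) (hG : G.IsSemiMarkovian)
    {W C S : Finset V} {i : V} (hC : G.IsCComponent W C) (hiC : i ∈ C) (hS : insert i S ⊆ W)
    (hiS : i ∉ S) (hsink : ∀ j ∈ S, ¬ G.Adj (Sum.inl i) (Sum.inl j)) (v : V → A) :
    affinity M N S v - affinity M N (insert i S) v ≤
      coordSum (G.obsParents C)
        (fun x => affinity M N (C ∩ S) x - affinity M N (C ∩ insert i S) x) v := by
  have hSW : S ⊆ W := (Finset.subset_insert i S).trans hS
  have hiX : i ∉ C ∩ S := fun h => hiS (Finset.mem_inter.1 h).2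
  have hins : C ∩ insert i S = insert i (C ∩ S) := Finset.inter_insert_of_mem hiC
  have hsd : insert i S \ C = S \ C := Finset.insert_sdiff_of_mem _ hiC
  have hunion : ∀ X : Finset V, insert i X = X ∪ {i} := fun X => by
    rw [Finset.union_comm, Finset.insert_eq]
  have hsinkX : ∀ j ∈ C ∩ S, ¬ G.Adj (Sum.inl i) (Sum.inl j) :=
    fun j hj => hsink j (Finset.mem_inter.1 hj).2
  set X := C ∩ S with hX
  set R := S \ C with hR
  set P := G.obsParents C with hP
  have hXi : insert i X ⊆ C := hins ▸ Finset.inter_subset_left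
  have hXC : X ⊆ C := Finset.inter_subset_left
  let a : (V → A) → ℝ := fun x => √(M.cFactor X x * N.cFactor X x)
  let a' : (V → A) → ℝ := fun x => √(M.cFactor (insert i X) x * N.cFactor (insert i X) x)
  let r : (V → A) → ℝ := fun x => √(M.cFactor R x * N.cFactor R x)
  let b : (V → A) → ℝ := fun x => a x - coordSum {i} a' x
  have hb : ∀ x, 0 ≤ b x := by
    intro x
    have := coordSum_sqrt_mul_le {i} (M.cFactor_nonneg (insert i X))
      (N.cFactor_nonneg (insert i X)) x
    rw [M.coordSum_singleton_cFactor hG hiX hsinkX, N.coordSum_singleton_cFactor hG hiX hsinkX]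
      at this
    exact sub_nonneg.2 this
  -- `b` depends only on the values of the c-component and its parents
  have hlocal : ∀ (L : CausalBayesNet G A) (Z : Finset V), Z ⊆ C → ∀ x y : V → A,
      (∀ j, j ∈ C ∨ j ∈ P → x j = y j) → L.cFactor Z x = L.cFactor Z y := by
    intro L Z hZ x y hxy
    refine L.cFactor_congr hG (fun j hj => hxy j (.inl (hZ hj))) fun j hj k hk => hxy k ?_
    by_cases hkC : k ∈ C
    · exact .inl hkC
    · exact .inr (CausalGraph.mem_obsParents.2 ⟨hkC, j, hZ hj, hk⟩)
  have hbcongr : ∀ x y : V → A, (∀ j, j ∈ C ∨ j ∈ P → x j = y j) → b x = b y := by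
    intro x y hxy
    have h1 : a x = a y := by
      simp only [a, hlocal M X hXC x y hxy, hlocal N X hXC x y hxy]
    have h2 : coordSum {i} a' x = coordSum {i} a' y := by
      simp only [coordSum_singleton]
      refine Finset.sum_congr rfl fun t _ => ?_
      have hupd : ∀ j, j ∈ C ∨ j ∈ P → Function.update x i t j = Function.update y i t j := by
        intro j hj
        by_cases hji : j = i
        · subst hji; simp
        · simp [hji, hxy j hj]
      simp only [a', hlocal M _ hXi _ _ hupd, hlocal N _ hXi _ _ hupd]
    simp only [b, h1, h2]
  -- Changing `R` affects `b` only through `Pa(C)`, so `b x` is one of the nonnegative terms of the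
  -- sum over `Pa(C)`.
  have hble : ∀ y x : V → A, (∀ j ∉ R, x j = y j) → b x ≤ coordSum P b y := by
    intro y x hxy
    have e : b x = b (fun j => if j ∈ P then x j else y j) := by
      refine hbcongr _ _ fun j hj => ?_
      by_cases hjP : j ∈ P
      · simp [hjP]
      · have hjC : j ∈ C := hj.resolve_right hjP
        have hjR : j ∉ R := fun h => (Finset.mem_sdiff.1 h).2 hjC
        simp [hjP, hxy j hjR]
    rw [e]
    exact le_coordSum hb fun j hj => by simp [hj]
  have hr : ∀ y, coordSum R r y ≤ 1 := affinity_le_one M N hG R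
  have hRb : ∀ y, coordSum R (fun x => b x * r x) y ≤ coordSum P b y := by
    intro y
    have hPb : 0 ≤ coordSum P b y := (hb y).trans (hble y y fun _ _ => rfl)
    calc coordSum R (fun x => b x * r x) y
        ≤ coordSum R (fun x => r x * coordSum P b y) y :=
          coordSum_mono_of fun x hx => by
            rw [mul_comm]
            exact mul_le_mul_of_nonneg_left (hble y x hx) (Real.sqrt_nonneg _)
      _ = coordSum R r y * coordSum P b y := coordSum_mul_const _ _ _ _
      _ ≤ coordSum P b y := mul_le_of_le_one_left hPb (hr y)
  have hSu : S = X ∪ R := by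
    rw [hX, hR, Finset.inter_comm, Finset.union_comm, Finset.sdiff_union_inter]
  have hXR : Disjoint X R := Finset.disjoint_sdiff.mono_left hXC
  have hXP : Disjoint X P := Finset.disjoint_left.2 fun j hj hjP =>
    (CausalGraph.mem_obsParents.1 hjP).1 (hXC hj)
  have hnn : ∀ Z x, 0 ≤ M.cFactor Z x * N.cFactor Z x := fun Z x =>
    mul_nonneg (M.cFactor_nonneg Z x) (N.cFactor_nonneg Z x)
  have e1 : affinity M N S v = coordSum S (fun x => a x * r x) v := by
    refine coordSum_congr fun x _ => ?_
    rw [M.cFactor_inter_mul_sdiff hG hC hSW, N.cFactor_inter_mul_sdiff hG hC hSW,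
      mul_mul_mul_comm, Real.sqrt_mul (hnn _ _)]
  have e2 : affinity M N (insert i S) v =
      coordSum S (fun x => coordSum {i} a' x * r x) v := by
    rw [affinity, hunion S, coordSum_union (Finset.disjoint_singleton_right.2 hiS), ← hunion S]
    refine coordSum_congr fun x _ => ?_
    rw [← coordSum_mul_const]
    refine coordSum_congr fun y hy => ?_
    -- The factor of `R` leaves the sum over `i`, because `i` is neither in `R` nor a parent of `R`.
    have hRy : ∀ L : CausalBayesNet G A, L.cFactor R y = L.cFactor R x := by
      intro L
      refine L.cFactor_congr hG (fun j hj => hy j ?_) fun j hj k hk => hy k ?_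
      · rw [Finset.mem_singleton]
        exact fun e => (Finset.mem_sdiff.1 hj).2 (e ▸ hiC)
      · rw [Finset.mem_singleton]
        exact fun e => hsink j (Finset.mem_sdiff.1 hj).1 (e ▸ hk)
    rw [M.cFactor_inter_mul_sdiff hG hC hS, N.cFactor_inter_mul_sdiff hG hC hS,
      mul_mul_mul_comm, Real.sqrt_mul (hnn _ _), hsd, hins, hRy M, hRy N]
  have e3 : ∀ x, coordSum X b x = affinity M N X x - affinity M N (C ∩ insert i S) x := by
    intro x
    rw [coordSum_sub, hins, affinity, affinity, hunion X,
      coordSum_union (Finset.disjoint_singleton_right.2 hiX), ← hunion X]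
  calc affinity M N S v - affinity M N (insert i S) v
      = coordSum S (fun x => b x * r x) v := by
        rw [e1, e2, ← coordSum_sub]
        exact coordSum_congr fun x _ => (sub_mul _ _ _).symm
    _ = coordSum X (coordSum R fun x => b x * r x) v := by
        rw [← coordSum_union hXR, ← hSu]
    _ ≤ coordSum X (coordSum P b) v := coordSum_mono_of fun y _ => hRb y
    _ = coordSum P (coordSum X b) v := coordSum_comm hXP _ _
    _ = _ := coordSum_congr fun x _ => e3 x

open Classical in
/-- Subadditivity of the squared Hellinger distance over c-components. -/
theorem one_sub_affinity_le (M N : CausalBayesNet G A) (hG : G.IsSemiMarkovian)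
    (W : Finset V) {S : Finset V} (hS : S ⊆ W) (v : V → A) :
    1 - affinity M N S v ≤ ∑ C with G.IsCComponent W C,
      coordSum (G.obsParents C) (fun x => 1 - affinity M N (C ∩ S) x) v := by
  induction S using Finset.strongInduction with
  | H S ih =>
    rcases S.eq_empty_or_nonempty with rfl | hne
    · have : ∀ x, affinity M N ∅ x = 1 := fun x => by
        simp [affinity, coordSum_empty, cFactor_empty _ hG]
      simp [this, coordSum]
    obtain ⟨i, hi, hsink⟩ := G.exists_sink hne
    obtain ⟨C₀, hC₀, hiC₀⟩ := G.exists_isCComponent (hS hi)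
    have hins : insert i (S.erase i) = S := Finset.insert_erase hi
    have hstep := affinity_sub_affinity_insert_le M N hG hC₀ hiC₀ (S := S.erase i)
      (by rwa [hins]) (Finset.notMem_erase i S)
      (fun j hj => hsink j (Finset.mem_of_mem_erase hj)) v
    rw [hins] at hstep
    have hrec := ih _ (Finset.erase_ssubset hi) ((Finset.erase_subset i S).trans hS)
    have hmem : C₀ ∈ Finset.univ.filter fun C => G.IsCComponent W C := by simpa using hC₀
    rw [← Finset.add_sum_erase _ _ hmem] at hrec ⊢
    -- Only the term of `C₀` changes when `i` is erased.
    have hrest : ∀ C ∈ (Finset.univ.filter fun C => G.IsCComponent W C).erase C₀,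
        C ∩ S.erase i = C ∩ S := by
      intro C hC
      have hiC : i ∉ C := fun h => (Finset.mem_erase.1 hC).1
        ((Finset.mem_filter.1 (Finset.mem_erase.1 hC).2).2.eq_of_mem hC₀ h hiC₀)
      rw [Finset.inter_erase, Finset.erase_eq_of_notMem]
      exact fun h => hiC (Finset.mem_inter.1 h).1
    rw [Finset.sum_congr rfl fun C hC => by rw [hrest C hC]] at hrec
    have hsplit : coordSum (G.obsParents C₀) (fun x => 1 - affinity M N (C₀ ∩ S) x) v =
        coordSum (G.obsParents C₀) (fun x => 1 - affinity M N (C₀ ∩ S.erase i) x) v +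
        coordSum (G.obsParents C₀)
          (fun x => affinity M N (C₀ ∩ S.erase i) x - affinity M N (C₀ ∩ S) x) v := by
      rw [← coordSum_add]
      exact coordSum_congr fun x _ => by ring
    rw [hsplit]
    linarith

theorem sqHellinger_doMarginal (M N : CausalBayesNet G A) (hG : G.IsSemiMarkovian)
    {T S : Finset V} (hTS : Disjoint T S)
    (h : ∀ i ∉ T, i ∉ S → ∀ j ∈ S, ¬ G.Adj (Sum.inl i) (Sum.inl j)) (v : V → A) :
    sqHellinger (M.doMarginal T (fun i => v i) S) (N.doMarginal T (fun i => v i) S) =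
      1 - affinity M N S v := by
  unfold sqHellinger affinity
  congr 1
  refine sum_eq_coordSum fun x hx => ?_
  have hv : (fun i : T => v i) = fun i : T => x i :=
    funext fun i => (hx i (Finset.disjoint_left.1 hTS i.2)).symm
  rw [hv, M.doMarginal_eq hG hTS h x, N.doMarginal_eq hG hTS h x]

theorem sqHellinger_doMarginal_compl (M N : CausalBayesNet G A) (hG : G.IsSemiMarkovian)
    (T : Finset V) (v : V → A) :
    sqHellinger (M.doMarginal T (fun i => v i) Tᶜ) (N.doMarginal T (fun i => v i) Tᶜ) =
      1 - affinity M N Tᶜ v :=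
  sqHellinger_doMarginal M N hG disjoint_compl_right
    (fun _ hi hi' => absurd (Finset.mem_compl.2 hi) hi') v

theorem sqHellinger_doMarginal_obsParents (M N : CausalBayesNet G A) (hG : G.IsSemiMarkovian)
    (C : Finset V) (v : V → A) :
    sqHellinger (M.doMarginal (G.obsParents C) (fun i => v i) C)
      (N.doMarginal (G.obsParents C) (fun i => v i) C) = 1 - affinity M N C v :=
  sqHellinger_doMarginal M N hG
    (Finset.disjoint_left.2 fun _ hi => (CausalGraph.mem_obsParents.1 hi).1)
    (fun _ hi hiC j hj hij => hi (CausalGraph.mem_obsParents.2 ⟨hiC, j, hj, hij⟩)) v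

end CausalBayesNet

/-! ### The final count -/

theorem theorem3 {V U A : Type*} [Fintype V] [DecidableEq V] [Fintype U] [DecidableEq U]
    [Fintype A] (d l : ℕ) (G : CausalGraph V U) (hG : G.InClass d l)
    (M N : CausalBayesNet G A) (γ : ℝ) (hγ : 0 ≤ γ) (T : Finset V)
    (hlocal : ∀ C : Finset V, G.IsCComponent Tᶜ C → ∀ a : G.obsParents C → A,
      sqHellinger (M.doMarginal (G.obsParents C) a C)
        (N.doMarginal (G.obsParents C) a C) ≤ γ) :
    ∀ t : T → A,
      sqHellinger (M.doMarginal T t Tᶜ) (N.doMarginal T t Tᶜ) ≤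
        γ * (Fintype.card A : ℝ) ^ (l * (d + 1)) * (Fintype.card V : ℝ) := by
  classical
  intro t
  have hA : Nonempty V → Nonempty A := fun _ => M.nonempty_alphabet
  -- Values off `T` are arbitrary; a letter is needed only if some vertex exists.
  obtain ⟨v, rfl⟩ : ∃ v : V → A, (fun i : T => v i) = t :=
    ⟨fun i => if hi : i ∈ T then t ⟨i, hi⟩ else (hA ⟨i⟩).some, by funext i; simp⟩
  rw [M.sqHellinger_doMarginal_compl N hG.semiMarkovian]
  refine (M.one_sub_affinity_le N hG.semiMarkovian Tᶜ Finset.Subset.rfl v).trans ?_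
  have hterm : ∀ C ∈ Finset.univ.filter (fun C => G.IsCComponent Tᶜ C),
      coordSum (G.obsParents C) (fun x => 1 - M.affinity N (C ∩ Tᶜ) x) v ≤
        γ * (Fintype.card A : ℝ) ^ (l * (d + 1)) := by
    intro C hC
    replace hC := (Finset.mem_filter.1 hC).2
    have hcard : (1 : ℝ) ≤ Fintype.card A := by
      obtain ⟨i, -⟩ := hC.1.1
      have := hA ⟨i⟩
      exact_mod_cast Fintype.card_pos (α := A)
    calc coordSum (G.obsParents C) (fun x => 1 - M.affinity N (C ∩ Tᶜ) x) v
        ≤ coordSum (G.obsParents C) (fun _ => γ) v := coordSum_mono_of fun x _ => by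
          rw [Finset.inter_eq_left.2 hC.1.2.1,
            ← M.sqHellinger_doMarginal_obsParents N hG.semiMarkovian]
          exact hlocal C hC _
      _ = γ * (Fintype.card A : ℝ) ^ (G.obsParents C).card := by
          rw [coordSum_const, mul_comm]
      _ ≤ γ * (Fintype.card A : ℝ) ^ (l * (d + 1)) := by
          gcongr
          exact hG.card_obsParents_le hC
  refine (Finset.sum_le_card_nsmul _ _ _ hterm).trans ?_
  rw [nsmul_eq_mul, mul_comm]
  gcongr
  exact G.card_cComponents_le Tᶜ
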